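/- Let $k>1$ be an integer and let $B_m$ denote the Bernoulli numbers, $\frac{t}{e^t-1}=\sum_{m\ge0}B_m\frac{t^m}{m!}$. All infinite series below converge absolutely. (i) For all real numbers $x,y\neq 0$, $$\sum_{n=1}^\infty \frac{\pi\tanh\left(\frac{2n-1}{2x}\pi y\right)}{(2n-1)^{2k-1}}\,x^{2k-1}y+(-1)^k\sum_{n=1}^\infty \frac{\pi\tanh\left(\frac{2n-1}{2y}\pi x\right)}{(2n-1)^{2k-1}}\,y^{2k-1}x=\sum_{\substack{k_1+k_2=k\\ k_1,k_2\ge 1}}\frac{(2^{2k_1}-1)(2^{2k_2}-1)\,|B_{2k_1}|\,B_{2k_2}}{(2k_1)!\,(2k_2)!}\,x^{2k_1}y^{2k_2}\pi^{2k}.$$ (ii) For all real numbers $\alpha,\beta$ with $\alpha\beta=\pi^2$, $$\alpha\beta^k\sum_{n=1}^\infty\frac{\tanh\left(\frac{2n-1}{2}\alpha\right)}{(2n-1)^{2k-1}}+(-1)^k\alpha^k\beta\sum_{n=1}^\infty\frac{\tanh\left(\frac{2n-1}{2}\beta\right)}{(2n-1)^{2k-1}}=\sum_{\substack{k_1+k_2=k\\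 k_1,k_2\ge 1}}\frac{(2^{2k_1}-1)(2^{2k_2}-1)\,|B_{2k_1}|\,B_{2k_2}}{(2k_1)!\,(2k_2)!}\,\alpha^{k_2}\beta^{k_1}\pi^{2k}.$$ (iii) For all real numbers $\alpha,\beta$ with $\alpha\beta=\pi^2$, writing $\eta(s)=\sum_{n=1}^\infty (2n-1)^{-s}$, $$\alpha^{-(k-1)}\left\{\eta(2k-1)-2\sum_{n=1}^\infty\frac{1}{(2n-1)^{2k-1}\left(e^{(2n-1)\alpha}+1\right)}\right\}-(-\beta)^{-(k-1)}\left\{\eta(2k-1)-2\sum_{n=1}^\infty\frac{1}{(2n-1)^{2k-1}\left(e^{(2n-1)\beta}+1\right)}\right\}=\sum_{\substack{k_1+k_2=k\\ k_1,k_2\ge 1}}\frac{(2^{2k_1}-1)(2^{2k_2}-1)\,|B_{2k_1}|\,B_{2k_2}}{(2k_1)!\,(2k_2)!}\,\alpha^{k_2}\beta^{k_1}.$$ -/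

import Mathlib

open scoped Nat

/-! Expanding `tanh` into partial fractions over odd integers turns each side of the reciprocity
into an absolutely convergent double series over pairs of odd `A`, `B`, with common factor `1 /
(A²y² + B²x²)`. Combining the term at `(A, B)` with the swapped term cancels that denominator
through a finite geometric sum (`tanhDoubleTerm_add_swap`). What remains is a finite sum of products
of series over odd integers with even exponents, evaluated by Euler's formula
(`hasSum_one_div_odd_pow_even`). The case `αβ = π²` is `x = π`, `y = α`; the exponential form
follows from `tanh (z/2) = 1 - 2/(e^z + 1)`. -/

theorem HasSum.of_eq {ι M : Type*} [AddCommMonoid M] [TopologicalSpace M] {f g : ι → M} {a b : M}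
    (h : HasSum f a) (hfg : ∀ i, g i = f i) (hab : b = a) : HasSum g b := by
  rw [hab, funext hfg]
  exact h

/-! ### Partial fractions of coth and tanh -/

theorem hasSum_coth {t : ℝ} (ht : t ≠ 0) :
    HasSum (fun n : ℕ => 2 * t / (t ^ 2 + ((n : ℝ) + 1) ^ 2))
      (Real.pi * (Real.cosh (Real.pi * t) / Real.sinh (Real.pi * t)) - 1 / t) := by
  have htC : (t : ℂ) ≠ 0 := by exact_mod_cast ht
  have hx : (t : ℂ) * Complex.I ∈ Complex.integerComplement := by
    rw [Complex.mem_integerComplement_iff]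
    rintro ⟨n, hn⟩
    apply ht
    simpa using (congrArg Complex.im hn).symm
  have h := (summable_cotTerm hx).hasSum
  simp only [cotTerm] at h
  rw [← cot_series_rep' hx] at h
  rw [← Complex.hasSum_ofReal]
  -- The cotangent expansion is taken at `t * I`; the factor `I` makes it real.
  refine (h.mul_left Complex.I).of_eq (fun n => ?_) ?_
  · have h1 : (t : ℂ) ^ 2 + ((n : ℂ) + 1) ^ 2 ≠ 0 := by
      have : t ^ 2 + ((n : ℝ) + 1) ^ 2 ≠ 0 := by positivity
      exact_mod_cast this
    have hfac : ((t : ℂ) * Complex.I - (n + 1)) * ((t : ℂ) * Complex.I + (n + 1)) =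
        -((t : ℂ) ^ 2 + ((n : ℂ) + 1) ^ 2) := by
      linear_combination (t : ℂ) ^ 2 * Complex.I_sq
    have h2 := mul_ne_zero_iff.mp (hfac.trans_ne (neg_ne_zero.mpr h1))
    push_cast
    rw [one_div_add_one_div h2.1 h2.2, hfac]
    field_simp
    linear_combination (2 : ℂ) * t * Complex.I_sq
  · have hs : Complex.sinh (Real.pi * t) ≠ 0 := by
      have : Real.sinh (Real.pi * t) ≠ 0 := by
        rw [Ne, Real.sinh_eq_zero]; positivity
      exact_mod_cast this
    rw [Complex.cot_eq_cos_div_sin, ← mul_assoc, Complex.cos_mul_I, Complex.sin_mul_I]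
    push_cast
    field_simp

theorem two_mul_coth_sub_coth_half {t : ℝ} (ht : t ≠ 0) :
    2 * (Real.cosh t / Real.sinh t) - Real.cosh (t / 2) / Real.sinh (t / 2) =
      Real.tanh (t / 2) := by
  obtain ⟨s, rfl⟩ : ∃ s, t = 2 * s := ⟨t / 2, by ring⟩
  have hs : Real.sinh s ≠ 0 := by
    rw [Ne, Real.sinh_eq_zero]; rintro rfl; simp at ht
  have hc : Real.cosh s ≠ 0 := (Real.cosh_pos s).ne'
  rw [mul_div_cancel_left₀ _ two_ne_zero, Real.cosh_two_mul, Real.sinh_two_mul,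
    Real.tanh_eq_sinh_div_cosh]
  field_simp
  ring

/-- Twice the `coth` series at `t`, minus the series at `t / 2`, keeps only the odd integers; the
poles `2 / t` cancel. -/
theorem hasSum_tanh {t : ℝ} (ht : t ≠ 0) :
    HasSum (fun n : ℕ => 4 * t / (t ^ 2 + (2 * (n : ℝ) + 1) ^ 2))
      (Real.pi * Real.tanh (Real.pi * t / 2)) := by
  have hall := (hasSum_coth ht).mul_left 2
  have hev := hasSum_coth (div_ne_zero ht two_ne_zero)
  have hodd : Summable fun k : ℕ => 2 * (2 * t / (t ^ 2 + (((2 * k : ℕ) : ℝ) + 1) ^ 2)) :=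
    hall.summable.comp_injective (i := fun k : ℕ => 2 * k) fun a b h => by simpa using h
  have hev' : HasSum (fun k : ℕ => 2 * (2 * t / (t ^ 2 + (((2 * k + 1 : ℕ) : ℝ) + 1) ^ 2)))
      (Real.pi * (Real.cosh (Real.pi * (t / 2)) / Real.sinh (Real.pi * (t / 2))) - 1 / (t / 2)) := by
    refine hev.of_eq (fun k => ?_) rfl
    have : t ^ 2 + (((2 * k + 1 : ℕ) : ℝ) + 1) ^ 2 = 4 * ((t / 2) ^ 2 + ((k : ℝ) + 1) ^ 2) := by
      push_cast; ring
    rw [this]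
    have : (t / 2) ^ 2 + ((k : ℝ) + 1) ^ 2 ≠ 0 := by positivity
    field_simp
    ring
  have huniq := (hodd.hasSum.even_add_odd (f := fun n : ℕ =>
    2 * (2 * t / (t ^ 2 + ((n : ℝ) + 1) ^ 2))) hev').unique hall
  have hval : ∑' k : ℕ, 2 * (2 * t / (t ^ 2 + (((2 * k : ℕ) : ℝ) + 1) ^ 2)) =
      Real.pi * Real.tanh (Real.pi * t / 2) := by
    rw [← two_mul_coth_sub_coth_half (mul_ne_zero Real.pi_ne_zero ht), mul_div_assoc Real.pi t 2]
    have : 2 * (1 / t) = 1 / (t / 2) := by field_simp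
    linear_combination huniq - this
  rw [← hval]
  exact hodd.hasSum.of_eq (fun k => by push_cast; ring) rfl

/-! ### Even zeta values over odd integers -/

theorem abs_bernoulli_even {k : ℕ} (hk : k ≠ 0) :
    |(bernoulli (2 * k) : ℝ)| = (-1) ^ (k + 1) * (bernoulli (2 * k) : ℝ) := by
  have h0 : 0 ≤ (-1 : ℝ) ^ (k + 1) * (bernoulli (2 * k) : ℝ) := by
    -- The sign of the Bernoulli number is read off from `ζ(2k) ≥ 0`.
    have h1 := (hasSum_zeta_nat hk).nonneg fun n => by positivity
    have h2 : (-1 : ℝ) ^ (k + 1) * 2 ^ (2 * k - 1) * Real.pi ^ (2 * k) * (bernoulli (2 * k) : ℝ) /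
        (2 * k)! = (2 ^ (2 * k - 1) * Real.pi ^ (2 * k) / (2 * k)!) *
          ((-1 : ℝ) ^ (k + 1) * (bernoulli (2 * k) : ℝ)) := by ring
    rw [h2] at h1
    exact nonneg_of_mul_nonneg_right h1 (by positivity)
  rw [← abs_of_nonneg h0, abs_mul, abs_pow, abs_neg, abs_one, one_pow, one_mul]

theorem hasSum_one_div_odd_pow_even {k : ℕ} (hk : k ≠ 0) :
    HasSum (fun n : ℕ => 1 / (2 * (n : ℝ) + 1) ^ (2 * k))
      (((2 : ℝ) ^ (2 * k) - 1) * Real.pi ^ (2 * k) * |(bernoulli (2 * k) : ℝ)| /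
        (2 * ((2 * k)! : ℝ))) := by
  have hall := hasSum_zeta_nat hk
  have hodd : Summable fun n : ℕ => 1 / (((2 * n + 1 : ℕ) : ℝ)) ^ (2 * k) :=
    hall.summable.comp_injective (i := fun n : ℕ => 2 * n + 1) fun a b h => by simpa using h
  have hev := hall.mul_left (1 / (2 : ℝ) ^ (2 * k))
  have huniq := (HasSum.even_add_odd (f := fun n : ℕ => 1 / (n : ℝ) ^ (2 * k))
    (hev.of_eq (fun n => by push_cast; rw [mul_pow]; field_simp) rfl) hodd.hasSum).unique hall
  have hval : ∑' n : ℕ, 1 / (((2 * n + 1 : ℕ) : ℝ)) ^ (2 * k) =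
      ((2 : ℝ) ^ (2 * k) - 1) * Real.pi ^ (2 * k) * |(bernoulli (2 * k) : ℝ)| /
        (2 * ((2 * k)! : ℝ)) := by
    rw [abs_bernoulli_even hk, eq_sub_of_add_eq' huniq]
    obtain ⟨j, hj⟩ : ∃ j, 2 * k = j + 1 := ⟨2 * k - 1, by omega⟩
    rw [hj, Nat.add_sub_cancel, pow_succ (2 : ℝ) j]
    field_simp
  rw [← hval]
  exact hodd.hasSum.of_eq (fun n => by push_cast; rfl) rfl

/-! ### The double series and its symmetry -/

/-- The terms of the double series obtained by expanding `tanh` into partial fractions. -/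
noncomputable def tanhDoubleTerm (m : ℕ) (x y : ℝ) (p : ℕ × ℕ) : ℝ :=
  4 * x * y / ((2 * (p.1 : ℝ) + 1) ^ (2 * m + 2) *
    ((2 * (p.1 : ℝ) + 1) ^ 2 * y ^ 2 + (2 * (p.2 : ℝ) + 1) ^ 2 * x ^ 2))

theorem hasSum_tanhDoubleTerm_row (m : ℕ) {x y : ℝ} (hx : x ≠ 0) (hy : y ≠ 0) (a : ℕ) :
    HasSum (fun b : ℕ => tanhDoubleTerm m x y (a, b))
      (Real.pi * Real.tanh ((2 * (a : ℝ) + 1) / (2 * x) * Real.pi * y) /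
        (2 * (a : ℝ) + 1) ^ (2 * m + 3)) := by
  have ha : (2 * (a : ℝ) + 1) ≠ 0 := by positivity
  have h := (hasSum_tanh (div_ne_zero (mul_ne_zero ha hy) hx)).div_const
    ((2 * (a : ℝ) + 1) ^ (2 * m + 3))
  refine h.of_eq (fun b => ?_) ?_
  · have : (2 * (a : ℝ) + 1) ^ 2 * y ^ 2 + (2 * (b : ℝ) + 1) ^ 2 * x ^ 2 ≠ 0 := by positivity
    have h2 : ((2 * (a : ℝ) + 1) * y / x) ^ 2 + (2 * (b : ℝ) + 1) ^ 2 =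
      ((2 * (a : ℝ) + 1) ^ 2 * y ^ 2 + (2 * (b : ℝ) + 1) ^ 2 * x ^ 2) / x ^ 2 := by
      field_simp
    rw [tanhDoubleTerm, h2, pow_succ _ (2 * m + 2)]
    field_simp
  · congr 3
    field_simp

theorem summable_one_div_odd_pow {s : ℕ} (hs : 1 < s) :
    Summable fun n : ℕ => 1 / (2 * (n : ℝ) + 1) ^ s := by
  have h := (Real.summable_one_div_nat_pow.mpr hs).comp_injective
    (i := fun n : ℕ => 2 * n + 1) fun a b h => by simpa using h
  simpa [Function.comp_def] using h

/-- Dropping `A²y²` from the denominator leaves a product of two convergent series. -/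
theorem summable_tanhDoubleTerm (m : ℕ) {x y : ℝ} (hx : x ≠ 0) :
    Summable (tanhDoubleTerm m x y) := by
  have h := ((summable_one_div_odd_pow (s := 2 * m + 2) (by omega)).mul_of_nonneg
    (summable_one_div_odd_pow (s := 2) (by omega)) (fun n => by positivity)
    (fun n => by positivity)).mul_left (|4 * x * y| / x ^ 2)
  refine Summable.of_norm_bounded h fun p => ?_
  have hrw : |4 * x * y| / x ^ 2 *
      (1 / (2 * (p.1 : ℝ) + 1) ^ (2 * m + 2) * (1 / (2 * (p.2 : ℝ) + 1) ^ 2)) =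
      |4 * x * y| / ((2 * (p.1 : ℝ) + 1) ^ (2 * m + 2) * ((2 * (p.2 : ℝ) + 1) ^ 2 * x ^ 2)) := by
    field_simp
  have hden : 0 ≤ (2 * (p.1 : ℝ) + 1) ^ (2 * m + 2) *
      ((2 * (p.1 : ℝ) + 1) ^ 2 * y ^ 2 + (2 * (p.2 : ℝ) + 1) ^ 2 * x ^ 2) := by positivity
  rw [tanhDoubleTerm, Real.norm_eq_abs, abs_div, hrw, abs_of_nonneg hden]
  gcongr
  exact le_add_of_nonneg_left (by positivity)

theorem tanhDoubleTerm_add_swap (m : ℕ) {x y : ℝ} (hx : x ≠ 0) (hy : y ≠ 0) (a b : ℕ) :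
    tanhDoubleTerm m x y (a, b) * x ^ (2 * m + 3) * y
        + (-1) ^ m * tanhDoubleTerm m y x (b, a) * y ^ (2 * m + 3) * x
      = ∑ p ∈ Finset.HasAntidiagonal.antidiagonal m,
          4 * (-1) ^ p.2 * x ^ (2 * (p.1 + 1)) * y ^ (2 * (p.2 + 1)) *
            (1 / (2 * (a : ℝ) + 1) ^ (2 * (p.1 + 1)) * (1 / (2 * (b : ℝ) + 1) ^ (2 * (p.2 + 1)))) := by
  simp only [tanhDoubleTerm]
  have ha : 0 < 2 * (a : ℝ) + 1 := by positivity
  have hb : 0 < 2 * (b : ℝ) + 1 := by positivity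
  generalize 2 * (a : ℝ) + 1 = A at *
  generalize 2 * (b : ℝ) + 1 = B at *
  have hD : A ^ 2 * y ^ 2 + B ^ 2 * x ^ 2 ≠ 0 := by positivity
  -- With `u = (x/A)²` and `v = -(y/B)²`, the two terms add up to a multiple of `(u^(m+1) - v^(m+1))
  -- / (u - v)`.
  have hg := geom_sum₂_mul ((x / A) ^ 2) (-(y / B) ^ 2) (m + 1)
  have hR : ∑ p ∈ Finset.HasAntidiagonal.antidiagonal m,
          4 * (-1) ^ p.2 * x ^ (2 * (p.1 + 1)) * y ^ (2 * (p.2 + 1)) *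
            (1 / A ^ (2 * (p.1 + 1)) * (1 / B ^ (2 * (p.2 + 1)))) =
      4 * (x / A) ^ 2 * (y / B) ^ 2 *
        ∑ i ∈ Finset.range (m + 1), ((x / A) ^ 2) ^ i * (-(y / B) ^ 2) ^ (m + 1 - 1 - i) := by
    rw [Nat.add_sub_cancel, ← Nat.succ_eq_add_one,
      ← Finset.Nat.sum_antidiagonal_eq_sum_range_succ
        (fun i j => ((x / A) ^ 2) ^ i * (-(y / B) ^ 2) ^ j), Finset.mul_sum]
    refine Finset.sum_congr rfl fun p _ => ?_
    rw [neg_pow ((y / B) ^ 2), ← pow_mul, ← pow_mul, div_pow, div_pow, div_pow, div_pow,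
      mul_add 2 p.1, mul_add 2 p.2, pow_add, pow_add, pow_add, pow_add, mul_one]
    field_simp
  have hd : (x / A) ^ 2 - -(y / B) ^ 2 = (A ^ 2 * y ^ 2 + B ^ 2 * x ^ 2) / (A ^ 2 * B ^ 2) := by
    field_simp
    ring
  rw [hd, ← eq_div_iff (by positivity)] at hg
  rw [hR, hg, neg_pow ((y / B) ^ 2), ← pow_mul, ← pow_mul, div_pow, div_pow, div_pow, div_pow,
    add_comm (B ^ 2 * x ^ 2), mul_add 2 m 1, pow_succ (-1 : ℝ) m]
  field_simp
  ring

theorem hasSum_mul_tsum_of_nonneg {ι κ : Type*} {f : ι → ℝ} {g : κ → ℝ} (hf : Summable f)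
    (hg : Summable g) (hf0 : 0 ≤ f) (hg0 : 0 ≤ g) :
    HasSum (fun q : ι × κ => f q.1 * g q.2) ((∑' i, f i) * ∑' j, g j) :=
  hf.hasSum.mul hg.hasSum (hf.mul_of_nonneg hg hf0 hg0)

theorem tanh_reciprocity_antidiagonal (m : ℕ) {x y : ℝ} (hx : x ≠ 0) (hy : y ≠ 0) :
    (∑' n : ℕ, Real.pi * Real.tanh ((2 * (n : ℝ) + 1) / (2 * x) * Real.pi * y) /
          (2 * (n : ℝ) + 1) ^ (2 * m + 3)) * x ^ (2 * m + 3) * y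
      + (-1) ^ m *
        (∑' n : ℕ, Real.pi * Real.tanh ((2 * (n : ℝ) + 1) / (2 * y) * Real.pi * x) /
          (2 * (n : ℝ) + 1) ^ (2 * m + 3)) * y ^ (2 * m + 3) * x
      = ∑ p ∈ Finset.HasAntidiagonal.antidiagonal m,
          4 * (-1) ^ p.2 * x ^ (2 * (p.1 + 1)) * y ^ (2 * (p.2 + 1)) *
            ((∑' n : ℕ, 1 / (2 * (n : ℝ) + 1) ^ (2 * (p.1 + 1))) *
              ∑' n : ℕ, 1 / (2 * (n : ℝ) + 1) ^ (2 * (p.2 + 1))) := by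
  have key : ∀ {x y : ℝ}, x ≠ 0 → y ≠ 0 → HasSum (tanhDoubleTerm m x y)
      (∑' n : ℕ, Real.pi * Real.tanh ((2 * (n : ℝ) + 1) / (2 * x) * Real.pi * y) /
          (2 * (n : ℝ) + 1) ^ (2 * m + 3)) := by
    intro x y hx hy
    have h := (summable_tanhDoubleTerm m (y := y) hx).hasSum
    rwa [← (h.prod_fiberwise (hasSum_tanhDoubleTerm_row m hx hy)).tsum_eq] at h
  have h1 := ((key hx hy).mul_right (x ^ (2 * m + 3))).mul_right y
  have h2 := ((((Equiv.prodComm ℕ ℕ).hasSum_iff.mpr (key hy hx)).mul_left ((-1) ^ m)).mul_right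
    (y ^ (2 * m + 3))).mul_right x
  refine (h1.add h2).unique ?_
  have h3 : HasSum (fun q : ℕ × ℕ => ∑ p ∈ Finset.HasAntidiagonal.antidiagonal m,
          4 * (-1) ^ p.2 * x ^ (2 * (p.1 + 1)) * y ^ (2 * (p.2 + 1)) *
            (1 / (2 * (q.1 : ℝ) + 1) ^ (2 * (p.1 + 1)) *
              (1 / (2 * (q.2 : ℝ) + 1) ^ (2 * (p.2 + 1)))))
      (∑ p ∈ Finset.HasAntidiagonal.antidiagonal m,
          4 * (-1) ^ p.2 * x ^ (2 * (p.1 + 1)) * y ^ (2 * (p.2 + 1)) *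
            ((∑' n : ℕ, 1 / (2 * (n : ℝ) + 1) ^ (2 * (p.1 + 1))) *
              ∑' n : ℕ, 1 / (2 * (n : ℝ) + 1) ^ (2 * (p.2 + 1)))) := by
    refine hasSum_sum fun p _ => HasSum.mul_left _ ?_
    have e1 := summable_one_div_odd_pow (s := 2 * (p.1 + 1)) (by omega)
    have e2 := summable_one_div_odd_pow (s := 2 * (p.2 + 1)) (by omega)
    exact hasSum_mul_tsum_of_nonneg e1 e2 (fun n => by positivity) fun n => by positivity
  exact h3.of_eq (fun q => tanhDoubleTerm_add_swap m hx hy q.1 q.2) rfl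

theorem sum_antidiagonal_filter_one_le {M : Type*} [AddCommMonoid M] (m : ℕ) (f : ℕ × ℕ → M) :
    ∑ p ∈ (Finset.HasAntidiagonal.antidiagonal (m + 2)).filter
        (fun p : ℕ × ℕ => 1 ≤ p.1 ∧ 1 ≤ p.2), f p =
      ∑ p ∈ Finset.HasAntidiagonal.antidiagonal m, f (p.1 + 1, p.2 + 1) := by
  symm
  refine Finset.sum_bij' (fun p _ => (p.1 + 1, p.2 + 1)) (fun p _ => (p.1 - 1, p.2 - 1))
    ?_ ?_ ?_ ?_ ?_
  · intro p hp; simp at hp ⊢; omega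
  · intro p hp; simp at hp ⊢; omega
  · intro p hp; simp
  · intro p hp; simp at hp; ext <;> simp <;> omega
  · intro p hp; rfl

/-- The sign `(-1) ^ j` is that of the second Bernoulli number, so only the first keeps its absolute
value. -/
theorem four_mul_tsum_odd_pow_mul_tsum_odd_pow (i j : ℕ) :
    4 * (-1) ^ j * ((∑' n : ℕ, 1 / (2 * (n : ℝ) + 1) ^ (2 * (i + 1))) *
        ∑' n : ℕ, 1 / (2 * (n : ℝ) + 1) ^ (2 * (j + 1))) =
      ((2 : ℝ) ^ (2 * (i + 1)) - 1) * ((2 : ℝ) ^ (2 * (j + 1)) - 1) *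
          |(bernoulli (2 * (i + 1)) : ℝ)| * (bernoulli (2 * (j + 1)) : ℝ) /
        (((2 * (i + 1))! : ℝ) * ((2 * (j + 1))! : ℝ)) * Real.pi ^ (2 * (i + j + 2)) := by
  have hB : (bernoulli (2 * (j + 1)) : ℝ) = (-1) ^ j * |(bernoulli (2 * (j + 1)) : ℝ)| := by
    rw [abs_bernoulli_even (Nat.succ_ne_zero j), ← mul_assoc, ← pow_add,
      Even.neg_one_pow ⟨j + 1, by omega⟩, one_mul]
  rw [(hasSum_one_div_odd_pow_even (Nat.succ_ne_zero i)).tsum_eq,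
    (hasSum_one_div_odd_pow_even (Nat.succ_ne_zero j)).tsum_eq,
    show 2 * (i + j + 2) = 2 * (i + 1) + 2 * (j + 1) by ring, pow_add Real.pi]
  simp only [Nat.succ_eq_add_one]
  generalize |(bernoulli (2 * (i + 1)) : ℝ)| = b
  generalize |(bernoulli (2 * (j + 1)) : ℝ)| = c at hB ⊢
  rw [hB]
  field_simp
  ring

theorem tanh_reciprocity (m : ℕ) {x y : ℝ} (hx : x ≠ 0) (hy : y ≠ 0) :
    (∑' n : ℕ, Real.pi * Real.tanh ((2 * (n : ℝ) + 1) / (2 * x) * Real.pi * y) /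
          (2 * (n : ℝ) + 1) ^ (2 * m + 3)) * x ^ (2 * m + 3) * y
      + (-1) ^ m *
        (∑' n : ℕ, Real.pi * Real.tanh ((2 * (n : ℝ) + 1) / (2 * y) * Real.pi * x) /
          (2 * (n : ℝ) + 1) ^ (2 * m + 3)) * y ^ (2 * m + 3) * x
      = ∑ p ∈ (Finset.HasAntidiagonal.antidiagonal (m + 2)).filter
          (fun p : ℕ × ℕ => 1 ≤ p.1 ∧ 1 ≤ p.2),
            ((2 : ℝ) ^ (2 * p.1) - 1) * ((2 : ℝ) ^ (2 * p.2) - 1) *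
                |(bernoulli (2 * p.1) : ℝ)| * (bernoulli (2 * p.2) : ℝ) /
              (((2 * p.1)! : ℝ) * ((2 * p.2)! : ℝ)) *
              x ^ (2 * p.1) * y ^ (2 * p.2) * Real.pi ^ (2 * (m + 2)) := by
  rw [tanh_reciprocity_antidiagonal m hx hy, sum_antidiagonal_filter_one_le]
  refine Finset.sum_congr rfl fun p hp => ?_
  have h := four_mul_tsum_odd_pow_mul_tsum_odd_pow p.1 p.2
  rw [Finset.HasAntidiagonal.mem_antidiagonal.mp hp] at h
  linear_combination x ^ (2 * (p.1 + 1)) * y ^ (2 * (p.2 + 1)) * h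

/-! ### Specialization to αβ = π² -/

theorem tanh_half_eq_one_sub (z : ℝ) : Real.tanh (z / 2) = 1 - 2 / (Real.exp z + 1) := by
  obtain ⟨s, rfl⟩ : ∃ s, z = 2 * s := ⟨z / 2, by ring⟩
  have h : Real.exp (2 * s) = Real.exp s * Real.exp s := by rw [← Real.exp_add]; ring_nf
  rw [mul_div_cancel_left₀ _ two_ne_zero, Real.tanh_eq, Real.exp_neg, h]
  have := Real.exp_pos s
  field_simp
  ring

theorem summable_tanh_div_odd_pow {s : ℕ} (hs : 1 < s) (α : ℝ) :
    Summable fun n : ℕ => Real.tanh ((2 * (n : ℝ) + 1) / 2 * α) / (2 * (n : ℝ) + 1) ^ s := by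
  refine Summable.of_norm_bounded (summable_one_div_odd_pow hs) fun n => ?_
  rw [Real.norm_eq_abs, abs_div, abs_of_nonneg (show 0 ≤ (2 * (n : ℝ) + 1) ^ s by positivity)]
  gcongr
  exact (Real.abs_tanh_lt_one _).le

theorem summable_one_div_odd_pow_mul_exp_add_one {s : ℕ} (hs : 1 < s) (α : ℝ) :
    Summable fun n : ℕ =>
      1 / ((2 * (n : ℝ) + 1) ^ s * (Real.exp ((2 * (n : ℝ) + 1) * α) + 1)) := by
  refine Summable.of_nonneg_of_le (fun n => by positivity) (fun n => ?_)
    (summable_one_div_odd_pow hs)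
  gcongr
  exact le_mul_of_one_le_right (by positivity) (le_add_of_nonneg_left (by positivity))

theorem tsum_tanh_div_odd_pow {s : ℕ} (hs : 1 < s) (α : ℝ) :
    ∑' n : ℕ, Real.tanh ((2 * (n : ℝ) + 1) / 2 * α) / (2 * (n : ℝ) + 1) ^ s =
      (∑' n : ℕ, 1 / (2 * (n : ℝ) + 1) ^ s) - 2 * ∑' n : ℕ,
        1 / ((2 * (n : ℝ) + 1) ^ s * (Real.exp ((2 * (n : ℝ) + 1) * α) + 1)) := by
  refine (((summable_one_div_odd_pow hs).hasSum.sub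
    ((summable_one_div_odd_pow_mul_exp_add_one hs α).hasSum.mul_left 2)).of_eq
      (fun n => ?_) rfl).tsum_eq
  rw [div_mul_eq_mul_div, tanh_half_eq_one_sub]
  field_simp

theorem tanh_reciprocity_of_mul_eq_pi_sq (m : ℕ) {α β : ℝ} (h : α * β = Real.pi ^ 2) :
    α * β ^ (m + 2) * (∑' n : ℕ, Real.tanh ((2 * (n : ℝ) + 1) / 2 * α) /
          (2 * (n : ℝ) + 1) ^ (2 * m + 3))
      + (-1) ^ m * α ^ (m + 2) * β * (∑' n : ℕ, Real.tanh ((2 * (n : ℝ) + 1) / 2 * β) /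
          (2 * (n : ℝ) + 1) ^ (2 * m + 3))
      = ∑ p ∈ (Finset.HasAntidiagonal.antidiagonal (m + 2)).filter
          (fun p : ℕ × ℕ => 1 ≤ p.1 ∧ 1 ≤ p.2),
            ((2 : ℝ) ^ (2 * p.1) - 1) * ((2 : ℝ) ^ (2 * p.2) - 1) *
                |(bernoulli (2 * p.1) : ℝ)| * (bernoulli (2 * p.2) : ℝ) /
              (((2 * p.1)! : ℝ) * ((2 * p.2)! : ℝ)) *
              α ^ p.2 * β ^ p.1 * Real.pi ^ (2 * (m + 2)) := by
  have hpi := Real.pi_ne_zero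
  have hα : α ≠ 0 := by rintro rfl; simp [eq_comm] at h
  have hβ : Real.pi / α * Real.pi = β := by field_simp; rw [h]
  have key := tanh_reciprocity m hpi hα
  have e1 : ∀ n : ℕ, (2 * (n : ℝ) + 1) / (2 * Real.pi) * Real.pi * α =
      (2 * (n : ℝ) + 1) / 2 * α := fun n => by field_simp
  have e2 : ∀ n : ℕ, (2 * (n : ℝ) + 1) / (2 * α) * Real.pi * Real.pi =
      (2 * (n : ℝ) + 1) / 2 * β := fun n => by rw [← hβ]; field_simp
  simp only [e1, e2, mul_div_assoc Real.pi, tsum_mul_left] at key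
  -- Since `p.1 + p.2 = m + 2`, this factor turns `α ^ p.2 * β ^ p.1` into `π ^ (2 * p.1) * α ^ (2 *
  -- p.2)`.
  refine mul_left_cancel₀ (pow_ne_zero (m + 2) hα) ?_
  have p1 : Real.pi * Real.pi ^ (2 * m + 3) = α ^ (m + 2) * β ^ (m + 2) := by
    rw [← mul_pow, h, ← pow_mul]; ring
  have hR : α ^ (m + 2) * ∑ p ∈ (Finset.HasAntidiagonal.antidiagonal (m + 2)).filter
          (fun p : ℕ × ℕ => 1 ≤ p.1 ∧ 1 ≤ p.2),
            ((2 : ℝ) ^ (2 * p.1) - 1) * ((2 : ℝ) ^ (2 * p.2) - 1) *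
                |(bernoulli (2 * p.1) : ℝ)| * (bernoulli (2 * p.2) : ℝ) /
              (((2 * p.1)! : ℝ) * ((2 * p.2)! : ℝ)) *
              α ^ p.2 * β ^ p.1 * Real.pi ^ (2 * (m + 2)) =
      ∑ p ∈ (Finset.HasAntidiagonal.antidiagonal (m + 2)).filter
          (fun p : ℕ × ℕ => 1 ≤ p.1 ∧ 1 ≤ p.2),
            ((2 : ℝ) ^ (2 * p.1) - 1) * ((2 : ℝ) ^ (2 * p.2) - 1) *
                |(bernoulli (2 * p.1) : ℝ)| * (bernoulli (2 * p.2) : ℝ) /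
              (((2 * p.1)! : ℝ) * ((2 * p.2)! : ℝ)) *
              Real.pi ^ (2 * p.1) * α ^ (2 * p.2) * Real.pi ^ (2 * (m + 2)) := by
    rw [Finset.mul_sum]
    refine Finset.sum_congr rfl fun p hp => ?_
    rw [← Finset.HasAntidiagonal.mem_antidiagonal.mp (Finset.mem_filter.mp hp).1, pow_mul Real.pi 2 p.1, ← h,
      mul_pow, pow_add α, mul_comm 2 p.2, pow_mul α, pow_two (α ^ p.2)]
    ring
  rw [hR, ← key]
  generalize (∑' n : ℕ, Real.tanh ((2 * (n : ℝ) + 1) / 2 * α) / _) = S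
  generalize (∑' n : ℕ, Real.tanh ((2 * (n : ℝ) + 1) / 2 * β) / _) = T
  have p2 : α ^ (2 * m + 3) * Real.pi ^ 2 = α ^ (m + 2) * α ^ (m + 2) * β := by
    rw [← h]; ring
  linear_combination (-(S * α)) * p1 - (-1) ^ m * T * p2

theorem summable_pi_mul_tanh_div_odd_pow {s : ℕ} (hs : 1 < s) (x y : ℝ) :
    Summable fun n : ℕ =>
      Real.pi * Real.tanh ((2 * (n : ℝ) + 1) / (2 * x) * Real.pi * y) / (2 * (n : ℝ) + 1) ^ s := by
  have h := (summable_tanh_div_odd_pow hs (Real.pi * y / x)).mul_left Real.pi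
  refine h.congr fun n => ?_
  rw [← mul_div_assoc]
  congr 3
  ring

theorem theorem2p4 (k : ℕ) (hk : 1 < k) :
    -- the general reciprocity
    (∀ x y : ℝ, x ≠ 0 → y ≠ 0 →
      Summable (fun n : ℕ =>
        Real.pi * Real.tanh ((2 * (n : ℝ) + 1) / (2 * x) * Real.pi * y) /
          (2 * (n : ℝ) + 1) ^ (2 * k - 1)) ∧
      Summable (fun n : ℕ =>
        Real.pi * Real.tanh ((2 * (n : ℝ) + 1) / (2 * y) * Real.pi * x) /
          (2 * (n : ℝ) + 1) ^ (2 * k - 1)) ∧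
      (∑' n : ℕ, Real.pi * Real.tanh ((2 * (n : ℝ) + 1) / (2 * x) * Real.pi * y) /
            (2 * (n : ℝ) + 1) ^ (2 * k - 1)) * x ^ (2 * k - 1) * y
        + (-1) ^ k *
          (∑' n : ℕ, Real.pi * Real.tanh ((2 * (n : ℝ) + 1) / (2 * y) * Real.pi * x) /
            (2 * (n : ℝ) + 1) ^ (2 * k - 1)) * y ^ (2 * k - 1) * x
        = ∑ p ∈ (Finset.HasAntidiagonal.antidiagonal k).filter (fun p : ℕ × ℕ => 1 ≤ p.1 ∧ 1 ≤ p.2),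
            ((2 : ℝ) ^ (2 * p.1) - 1) * ((2 : ℝ) ^ (2 * p.2) - 1) *
                |(bernoulli (2 * p.1) : ℝ)| * (bernoulli (2 * p.2) : ℝ) /
              (((2 * p.1)! : ℝ) * ((2 * p.2)! : ℝ)) *
              x ^ (2 * p.1) * y ^ (2 * p.2) * Real.pi ^ (2 * k)) ∧
    -- the two specializations to `α * β = π ^ 2`
    (∀ α β : ℝ, α * β = Real.pi ^ 2 →
      (Summable (fun n : ℕ =>
          Real.tanh ((2 * (n : ℝ) + 1) / 2 * α) / (2 * (n : ℝ) + 1) ^ (2 * k - 1)) ∧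
        Summable (fun n : ℕ =>
          Real.tanh ((2 * (n : ℝ) + 1) / 2 * β) / (2 * (n : ℝ) + 1) ^ (2 * k - 1)) ∧
        α * β ^ k * (∑' n : ℕ, Real.tanh ((2 * (n : ℝ) + 1) / 2 * α) /
              (2 * (n : ℝ) + 1) ^ (2 * k - 1))
          + (-1) ^ k * α ^ k * β * (∑' n : ℕ, Real.tanh ((2 * (n : ℝ) + 1) / 2 * β) /
              (2 * (n : ℝ) + 1) ^ (2 * k - 1))
          = ∑ p ∈ (Finset.HasAntidiagonal.antidiagonal k).filter (fun p : ℕ × ℕ => 1 ≤ p.1 ∧ 1 ≤ p.2),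
              ((2 : ℝ) ^ (2 * p.1) - 1) * ((2 : ℝ) ^ (2 * p.2) - 1) *
                  |(bernoulli (2 * p.1) : ℝ)| * (bernoulli (2 * p.2) : ℝ) /
                (((2 * p.1)! : ℝ) * ((2 * p.2)! : ℝ)) *
                α ^ p.2 * β ^ p.1 * Real.pi ^ (2 * k)) ∧
      (Summable (fun n : ℕ => 1 / (2 * (n : ℝ) + 1) ^ (2 * k - 1)) ∧
        Summable (fun n : ℕ => 1 / ((2 * (n : ℝ) + 1) ^ (2 * k - 1) *
          (Real.exp ((2 * (n : ℝ) + 1) * α) + 1))) ∧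
        Summable (fun n : ℕ => 1 / ((2 * (n : ℝ) + 1) ^ (2 * k - 1) *
          (Real.exp ((2 * (n : ℝ) + 1) * β) + 1))) ∧
        α ^ (-((k : ℤ) - 1)) *
            ((∑' n : ℕ, 1 / (2 * (n : ℝ) + 1) ^ (2 * k - 1))
              - 2 * ∑' n : ℕ, 1 / ((2 * (n : ℝ) + 1) ^ (2 * k - 1) *
                  (Real.exp ((2 * (n : ℝ) + 1) * α) + 1)))
          - (-β) ^ (-((k : ℤ) - 1)) *
            ((∑' n : ℕ, 1 / (2 * (n : ℝ) + 1) ^ (2 * k - 1))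
              - 2 * ∑' n : ℕ, 1 / ((2 * (n : ℝ) + 1) ^ (2 * k - 1) *
                  (Real.exp ((2 * (n : ℝ) + 1) * β) + 1)))
          = ∑ p ∈ (Finset.HasAntidiagonal.antidiagonal k).filter (fun p : ℕ × ℕ => 1 ≤ p.1 ∧ 1 ≤ p.2),
              ((2 : ℝ) ^ (2 * p.1) - 1) * ((2 : ℝ) ^ (2 * p.2) - 1) *
                  |(bernoulli (2 * p.1) : ℝ)| * (bernoulli (2 * p.2) : ℝ) /
                (((2 * p.1)! : ℝ) * ((2 * p.2)! : ℝ)) *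
                α ^ p.2 * β ^ p.1)) := by
  obtain ⟨m, rfl⟩ : ∃ m, k = m + 2 := ⟨k - 2, by omega⟩
  have hexp : 2 * (m + 2) - 1 = 2 * m + 3 := by omega
  have hsign : (-1 : ℝ) ^ (m + 2) = (-1) ^ m := by rw [pow_add]; simp
  have hs : 1 < 2 * m + 3 := by omega
  rw [hexp, hsign]
  refine ⟨fun x y hx hy => ⟨?_, ?_, tanh_reciprocity m hx hy⟩, fun α β h =>
    ⟨⟨summable_tanh_div_odd_pow hs α, summable_tanh_div_odd_pow hs β,
      tanh_reciprocity_of_mul_eq_pi_sq m h⟩, summable_one_div_odd_pow hs,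
      summable_one_div_odd_pow_mul_exp_add_one hs α,
      summable_one_div_odd_pow_mul_exp_add_one hs β, ?_⟩⟩
  · exact summable_pi_mul_tanh_div_odd_pow hs x y
  · exact summable_pi_mul_tanh_div_odd_pow hs y x
  · have hpi := Real.pi_ne_zero
    have hα : α ≠ 0 := by rintro rfl; simp [eq_comm] at h
    have hβ : β ≠ 0 := by rintro rfl; simp [eq_comm] at h
    have key := tanh_reciprocity_of_mul_eq_pi_sq m h
    -- Divide by `π ^ (2k) = α ^ k * β ^ k`, which leaves the negative powers of `α` and `β`.
    rw [← Finset.sum_mul, eq_comm, ← eq_div_iff (pow_ne_zero _ hpi), tsum_tanh_div_odd_pow hs,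
      tsum_tanh_div_odd_pow hs, pow_mul, ← h, mul_pow] at key
    rw [key, show -(((m + 2 : ℕ) : ℤ) - 1) = -((m + 1 : ℕ) : ℤ) by push_cast; ring,
      zpow_neg, zpow_neg, zpow_natCast, zpow_natCast, neg_pow β]
    generalize (∑' n : ℕ, 1 / (2 * (n : ℝ) + 1) ^ (2 * m + 3)) - _ = S
    generalize (∑' n : ℕ, 1 / (2 * (n : ℝ) + 1) ^ (2 * m + 3)) - _ = T
    -- The odd shift `m + 1` against `m` accounts for the minus sign in the exponential form.
    have hm : ((-1 : ℝ) ^ (m + 1))⁻¹ = -(-1) ^ m := by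
      rw [← inv_pow, inv_neg_one, pow_succ]; ring
    rw [mul_inv, hm, pow_succ α (m + 1), pow_succ β (m + 1)]
    field_simp
    ring
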